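/- For elements $a,b$ of a group put $[a,b]=a^{-1}b^{-1}ab$; commutator subgroups are left associated: for $N\trianglelefteq G$ and $d\ge 1$ let $\gamma_d(N)=[N,\dots,N]$ ($d$ copies of $N$, so $\gamma_1(N)=N$) and let $[G,{}_dN]=[G,N,\dots,N]$ ($d$ copies of $N$ after $G$). Let $F$ be the free group on the countably infinite alphabet consisting of distinct letters $x_{i,w}$ ($i\in\mathbb N$, $w$ a finite, possibly empty, word over $\{0,1\}$) and $y_i$ ($i\in\mathbb N$), and let $F'$ be its derived subgroup. Then there is an isomorphism $h:F\to F'$ such that $$h(x_{i,w})=[x_{i,w0},x_{i,w1}]\quad\text{for all } i,w. \qquad (*)$$ For every isomorphism $h:F\to F'$ satisfying $(*)$, let $G$ be the direct limit of $$F_1\xrightarrow{h}F_2\xrightarrow{h}F_3\xrightarrow{h}\cdots,\qquad F_i=F,$$ with canonical homomorphisms $h_i:F_i\to G$, and let $N=h_1(F_1)$. Then $G$ is an infinite perfect group, $N$ is a normal subgroup of $G$, and $$\gamma_d(N)>[G,{}_dN]\quad\text{(strict inclusion) for all integers } d\ge 1.$$ Moreover, for every $d\ge 1$ there are a subgroup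 $S$ of $G^{2^d}$ that is subdirect (it projects onto each of the $2^d$ factors) and a normal subgroup $K$ of $S$ such that $S/K$ is nilpotent of class exactly $d$. -/

import Mathlib

namespace PerfectLimit

/-- The commutator `[a, b] = a⁻¹ b⁻¹ a b` of two elements. -/
def comm {H : Type*} [Group H] (a b : H) : H := a⁻¹ * b⁻¹ * a * b

/-- For `N ≤ G` and `k ≥ 1`, the `k`-th term `γ_k(N) = [N, …, N]` (`k` copies, left associated) of
the lower central series of `N`, as a subgroup of `G`; thus `γ_1(N) = N`.
(Mathlib's series starts with index `0`; the value at `k = 0` is not used.) -/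
def gamma {G : Type*} [Group G] (N : Subgroup G) (k : ℕ) : Subgroup G :=
  N.lowerCentralSeries (k - 1)

/-- The left associated commutator subgroup `[G, N, …, N]` with `k` copies of `N`, where `[G] = G`. -/
def relComm {G : Type*} [Group G] (N : Subgroup G) : ℕ → Subgroup G
  | 0 => ⊤
  | k + 1 => ⁅relComm N k, N⁆

/-- A subgroup of a direct product is subdirect if it projects onto every factor. -/
def IsSubdirect {ι : Type*} {G : ι → Type*} [∀ i, Group (G i)] (S : Subgroup (∀ i, G i)) : Prop :=
  ∀ (i : ι) (g : G i), ∃ s ∈ S, s i = g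

/-- The countably infinite alphabet with letters `x i w` (for `i : ℕ` and `w` a word over `{0, 1}`)
and `y i` (for `i : ℕ`). -/
inductive Letter : Type
  | x (i : ℕ) (w : List Bool) : Letter
  | y (i : ℕ) : Letter

/-- The free group on the alphabet. -/
abbrev F : Type := FreeGroup Letter

/-- The condition `h(x_{i,w}) = [x_{i,w0}, x_{i,w1}]` on an isomorphism `h : F → F'`. -/
def SplitsLetters (h : F ≃* commutator F) : Prop :=
  ∀ (i : ℕ) (w : List Bool),
    (h (FreeGroup.of (Letter.x i w)) : F) =
      comm (FreeGroup.of (Letter.x i (w ++ [false]))) (FreeGroup.of (Letter.x i (w ++ [true])))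

/-- The isomorphism `h : F → F'`, regarded as an (injective) endomorphism of `F`. -/
def endo (h : F ≃* commutator F) : Monoid.End F :=
  (commutator F).subtype.comp h.toMonoidHom

/-- The transition map from the `i`-th to the `j`-th copy of `F` is `h` iterated `j - i` times. -/
def transition (h : F ≃* commutator F) (i j : ℕ) (_ : i ≤ j) : F →* F :=
  endo h ^ (j - i)

instance directedSystem (h : F ≃* commutator F) :
    DirectedSystem (fun _ : ℕ => F) (fun i j hij => transition h i j hij) where
  map_self i x := by
    change (endo h ^ (i - i)) x = x
    rw [Nat.sub_self, pow_zero]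
    rfl
  map_map k j i hij hjk x := by
    change (endo h ^ (k - j) * endo h ^ (j - i)) x = (endo h ^ (k - i)) x
    rw [← pow_add]
    congr 2
    omega

/-- The direct limit of `F → F → F → ⋯` in which every arrow is `h`. -/
abbrev Limit (h : F ≃* commutator F) : Type :=
  DirectLimit (fun _ : ℕ => F) (transition h)

/-- The canonical homomorphism from the `i`-th copy of `F` to the direct limit
(copies are numbered from `0`). -/
noncomputable def toLimit (h : F ≃* commutator F) (i : ℕ) : F →* Limit h where
  toFun x := ⟦⟨i, x⟩⟧
  map_one' := (DirectLimit.one_def (f := transition h) i).symm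
  map_mul' x y := (DirectLimit.mul_def (f := transition h) i x y).symm

/-- The image in the direct limit of the first copy of `F`. -/
noncomputable def firstCopy (h : F ≃* commutator F) : Subgroup (Limit h) :=
  (toLimit h 0).range

end PerfectLimit

/-!
The derived subgroup `F'` is free: its basis consists of the Schreier generators attached to the
edges of the Cayley graph of the free abelian group that lie outside a maximal tree
(`derivedEquiv`). The tree is described by the representatives `tr a`, in which the letters occur in
decreasing order. For letters `p < q`, the edge from `q` to `p + q` lies outside the tree and its
generator is `[p, q]`. Ordering the alphabet so that `x_{i,w0} < x_{i,w1}`, the commutators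
`[x_{i,w0}, x_{i,w1}]` thus form part of a basis of `F'`, and infinitely many basis elements are
left over for the letters `y_i`; this gives `h`.

In the limit, the image of `F` in a later copy of `F` is a term of the derived series of that copy,
so `G` is perfect and `N` is normal. Let `z = [x_{0,∅}, …, x_{d-1,∅}] ∈ γ_d(N)`. Identify the `2 ^ d`
coordinates of a power of `G` with the subsets of `{0, …, d - 1}`, the vertices of a cube, and let `S`
be the subgroup generated by the diagonal copy of `G` and by the copies of `N` on the faces of
codimension one (`cube`). A commutator of elements living on the faces of `α` and `β` lives on the
face of `α ∪ β`; hence, at the vertex `{0, …, d - 1}`, the term `γ_d(S)` contains a copy of `γ_d(N)`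
and `γ_{d+1}(S)` contains a copy of `[G, N, …, N]`. Both remaining claims therefore follow once the
copy of `z` at this vertex is known not to lie in `γ_{d+1}(S)` (`face_toLimit_leftComm_notMem`): the
inclusion `[G, N, …, N] ≤ γ_d(N)` is strict, and `S / γ_{d+1}(S)` has class exactly `d`.

As the lower central series commutes with ascending unions, it suffices to prove this in the `k`-th
copy of `F`, where `N` becomes the `k`-th derived subgroup and `z` becomes an iterated commutator of
`m = d * 2 ^ k` distinct letters. Represent these letters by the matrices `1 + E_{a,a+1}`, `a < m`, in
the order of their occurrence. Then `z` is represented by `1 + E_{0,m}`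
(`matRep_iter_leftComm`), while the `k`-th derived subgroup consists of matrices congruent to `1`
modulo the `2 ^ k`-th superdiagonal (`derivedSeries_le_congruence`). In the ring of matrix-valued
functions on the cube, a filtration by faces and superdiagonals (`filt`) bounds the lower central
series of `S`. For an element of `γ_{d+1}(S)` it forces the alternating sum over all vertices to
vanish (`alternating_sum_eq_zero`), whereas for the copy of `z` this sum is `± E_{0,m}`.
-/

namespace PerfectLimit

open scoped commutatorElement

/-! ### A free basis of the derived subgroup of a free group -/

namespace Schreier

open FreeGroup (of)
open Finsupp (single)

section Transversal

variable {X : Type*} [LinearOrder X]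

/-- The representative of an element `a` of the free abelian group in the free group: the product of
the powers `x ^ a x`, the letters `x` in decreasing order. -/
noncomputable def tr (a : X →₀ ℤ) : FreeGroup X :=
  ((a.support.sort (· ≥ ·)).map fun x => of x ^ a x).prod

theorem tr_zero : tr (0 : X →₀ ℤ) = 1 := by simp [tr]

/-- Adding a power of a letter larger than all others multiplies the representative on the left. -/
theorem tr_single_add {m : X} {f : X →₀ ℤ} (hf : ∀ c ∈ f.support, c < m) (k : ℤ) :
    tr (single m k + f) = of m ^ k * tr f := by
  rcases eq_or_ne k 0 with rfl | hk
  · simp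
  have hm : m ∉ f.support := fun h => lt_irrefl _ (hf m h)
  have hsupp : (single m k + f).support = insert m f.support := by
    rw [Finsupp.support_add_eq, Finsupp.support_single _ hk]
    · rfl
    · rw [Finsupp.support_single _ hk]
      simpa using hm
  have hfm : f m = 0 := by simpa using hm
  rw [tr, hsupp, Finset.sort_insert _ (fun b hb => (hf b hb).le) hm, List.map_cons,
    List.prod_cons, tr]
  congr 1
  · simp [hfm]
  · congr 1
    refine List.map_congr_left fun x hx => ?_
    have hx' : x ≠ m := fun h => hm (h ▸ (Finset.mem_sort _).1 hx)
    rw [Finsupp.add_apply, Finsupp.single_eq_of_ne hx', zero_add]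

theorem tr_single (m : X) (k : ℤ) : tr (single m k) = of m ^ k := by
  have := tr_single_add (m := m) (f := 0) (by simp) k
  simpa [tr_zero] using this

variable (X) in
/-- The edges of the Cayley graph of the free abelian group on `X` that do not lie in the maximal
tree described by the transversal `tr`. The edge `(a, x)` leads from `a` to `x + a`. -/
def Edge : Type _ :=
  {e : (X →₀ ℤ) × X // of e.2 * tr e.1 ≠ tr (single e.2 1 + e.1)}

open Classical in
/-- The label of an edge of the Cayley graph: trivial in the maximal tree, and otherwise a letter
of its own. -/
noncomputable def label (a : X →₀ ℤ) (x : X) : FreeGroup (Edge X) :=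
  if h : of x * tr a ≠ tr (single x 1 + a) then of ⟨(a, x), h⟩ else 1

/-- The action of the free group on the covering graph: a letter moves along an edge and records
its label. -/
noncomputable def act : FreeGroup X →* Equiv.Perm ((X →₀ ℤ) × FreeGroup (Edge X)) :=
  FreeGroup.lift fun x =>
    { toFun := fun p => (single x 1 + p.1, label p.1 x * p.2)
      invFun := fun p => (-single x 1 + p.1, (label (-single x 1 + p.1) x)⁻¹ * p.2)
      left_inv := fun p => by simp
      right_inv := fun p => by simp }

theorem act_of (x : X) (p : (X →₀ ℤ) × FreeGroup (Edge X)) :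
    act (of x) p = (single x 1 + p.1, label p.1 x * p.2) := by
  simp [act]

/-- The homomorphism from the free group on the edges outside the tree that sends an edge to the
Schreier generator belonging to it. -/
noncomputable def gen : FreeGroup (Edge X) →* FreeGroup X :=
  FreeGroup.lift fun e => (tr (single e.1.2 1 + e.1.1))⁻¹ * of e.1.2 * tr e.1.1

theorem gen_of (e : Edge X) :
    gen (of e) = (tr (single e.1.2 1 + e.1.1))⁻¹ * of e.1.2 * tr e.1.1 :=
  FreeGroup.lift_apply_of

theorem gen_label (a : X →₀ ℤ) (x : X) :
    gen (label a x) = (tr (single x 1 + a))⁻¹ * of x * tr a := by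
  unfold label
  split_ifs with h
  · exact gen_of _
  · rw [map_one, mul_assoc, not_not.1 h, inv_mul_cancel]

/-- The map `(a, g) ↦ tr a * gen g` is equivariant. -/
theorem tr_mul_gen_act (u : FreeGroup X) (p : (X →₀ ℤ) × FreeGroup (Edge X)) :
    tr (act u p).1 * gen (act u p).2 = u * (tr p.1 * gen p.2) := by
  induction u using FreeGroup.induction_on generalizing p with
  | C1 => simp
  | of x =>
    rw [act_of, map_mul, gen_label]
    group
  | inv_of x ih =>
    have := ih (act (of x)⁻¹ p)
    rw [← Equiv.Perm.mul_apply, ← map_mul, mul_inv_cancel, map_one, Equiv.Perm.one_apply] at this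
    rw [this, inv_mul_cancel_left]
  | mul u v hu hv => rw [map_mul, Equiv.Perm.mul_apply, hu, hv, mul_assoc]

theorem act_pow_of {m : X} {f : X →₀ ℤ} (hf : ∀ c ∈ f.support, c < m) (k : ℤ)
    (g : FreeGroup (Edge X)) :
    act (of m ^ k) (f, g) = (single m k + f, g) := by
  have step : ∀ j : ℤ, act (of m) (single m j + f, g) = (single m (j + 1) + f, g) := by
    intro j
    have hl : label (single m j + f) m = 1 := by
      refine dif_neg (not_not.2 ?_)
      rw [← add_assoc, ← Finsupp.single_add, tr_single_add hf, tr_single_add hf, ← mul_assoc,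
        zpow_add, zpow_one]
    rw [act_of]
    ext1
    · rw [← add_assoc, ← Finsupp.single_add, add_comm 1 j]
    · simp [hl]
  rw [map_zpow]
  induction k using Int.induction_on with
  | zero => simp
  | succ i ih => rw [add_comm, zpow_add, zpow_one, Equiv.Perm.mul_apply, ih, step, add_comm (i : ℤ)]
  | pred i ih =>
    rw [sub_eq_add_neg, add_comm, zpow_add, zpow_neg_one, Equiv.Perm.mul_apply, ih,
      Equiv.Perm.inv_eq_iff_eq, step]
    congr 3
    ring

/-- The representatives `tr a` run inside the tree, so they record no labels. -/
theorem act_tr (a : X →₀ ℤ) (g : FreeGroup (Edge X)) : act (tr a) (0, g) = (a, g) := by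
  induction a using Finsupp.induction_on_max with
  | zero => simp [tr_zero]
  | single_add m k f hf _ ih =>
    rw [tr_single_add hf, map_mul, Equiv.Perm.mul_apply, ih, act_pow_of hf]

/-- The action of `gen g` on the fibre over `0` recovers `g`. -/
theorem act_gen (g g' : FreeGroup (Edge X)) : act (gen g) (0, g') = (0, g * g') := by
  induction g using FreeGroup.induction_on generalizing g' with
  | C1 => simp
  | of e =>
    rw [gen_of, map_mul, map_mul, Equiv.Perm.mul_apply, Equiv.Perm.mul_apply, act_tr, act_of,
      map_inv, Equiv.Perm.inv_eq_iff_eq, act_tr]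
    have hl : label e.1.1 e.1.2 = of e := dif_pos e.2
    simp [hl]
  | inv_of e ih =>
    rw [map_inv, map_inv, Equiv.Perm.inv_eq_iff_eq, ih]
    simp
  | mul u v hu hv => rw [map_mul, map_mul, Equiv.Perm.mul_apply, hv, hu, mul_assoc]

theorem gen_injective : Function.Injective (gen (X := X)) := by
  intro g g' h
  have := act_gen g 1
  rw [h, act_gen] at this
  simpa using this.symm

/-- In the abelianization, `tr a` becomes the value at `a` of a homomorphism. -/
theorem abelianization_of_tr (a : X →₀ ℤ) :
    Additive.ofMul (Abelianization.of (tr a)) =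
      Finsupp.liftAddHom
        (fun x => zmultiplesHom _ (Additive.ofMul (Abelianization.of (of x)))) a := by
  induction a using Finsupp.induction_on_max with
  | zero => simp [tr_zero]
  | single_add m k f hf _ ih =>
    rw [tr_single_add hf, map_mul, ofMul_mul, ih, map_add]
    simp

theorem gen_mem (g : FreeGroup (Edge X)) : gen g ∈ commutator (FreeGroup X) := by
  rw [← Abelianization.ker_of, MonoidHom.mem_ker, ← MonoidHom.comp_apply]
  suffices (Abelianization.of.comp gen : FreeGroup (Edge X) →* _) = 1 by rw [this]; rfl
  refine FreeGroup.ext_hom _ _ fun e => Additive.ofMul.injective ?_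
  rw [MonoidHom.comp_apply, gen_of]
  simp [abelianization_of_tr]

/-- An element `u` of the derived subgroup moves `(0, 1)` to some `(0, g)`, and equivariance of
`(a, g) ↦ tr a * gen g` gives `gen g = u`. -/
theorem exists_gen_eq {u : FreeGroup X} (hu : u ∈ commutator (FreeGroup X)) : ∃ g, gen g = u := by
  have h1 : ∀ p, (act u p).1 = p.1 := by
    let A : FreeGroup X →* Multiplicative (X →₀ ℤ) :=
      FreeGroup.lift fun x => Multiplicative.ofAdd (single x 1)
    have key : ∀ (v : FreeGroup X) p, (act v p).1 = (A v).toAdd + p.1 := by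
      intro v
      induction v using FreeGroup.induction_on with
      | C1 => simp
      | of x => simp [act_of, A]
      | inv_of x ih =>
        intro p
        have := ih (act (of x)⁻¹ p)
        rw [← Equiv.Perm.mul_apply, ← map_mul, mul_inv_cancel, map_one,
          Equiv.Perm.one_apply] at this
        rw [this, map_inv A, toAdd_inv, neg_add_cancel_left]
      | mul v w hv hw =>
        intro p
        rw [map_mul, Equiv.Perm.mul_apply, hv, hw, map_mul, toAdd_mul, add_assoc]
    intro p
    rw [key, show A u = 1 from Abelianization.commutator_subset_ker A hu]
    simp
  refine ⟨(act u (0, 1)).2, ?_⟩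
  have := tr_mul_gen_act u (0, 1)
  rw [h1] at this
  simpa [tr_zero] using this

variable (X) in
/-- The derived subgroup of a free group is free on the edges outside the tree. -/
noncomputable def derivedEquiv : FreeGroup (Edge X) ≃* commutator (FreeGroup X) :=
  MulEquiv.ofBijective (gen.codRestrict _ gen_mem)
    ⟨fun _ _ h => gen_injective (Subtype.ext_iff.1 h), fun u => by
      obtain ⟨g, hg⟩ := exists_gen_eq u.2
      exact ⟨g, Subtype.ext hg⟩⟩

theorem of_mul_of_ne {p q : X} (h : p ≠ q) : of p * of q ≠ of q * of p := by
  intro h'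
  have := congrArg (FreeGroup.lift fun x =>
    if x = p then Equiv.swap (0 : Fin 3) 1 else Equiv.swap (1 : Fin 3) 2) h'
  simp only [map_mul, FreeGroup.lift_apply_of, if_true, if_neg h.symm] at this
  exact absurd this (by decide)

/-- For letters `p < q`, the edge from `q` to `p + q`. It is not in the tree because `q + p` is
represented by `q * p`. -/
noncomputable def commEdge {p q : X} (h : p < q) : Edge X :=
  ⟨(single q 1, p), by
    rw [add_comm, tr_single_add (by simp [h])]
    simpa [tr_single] using of_mul_of_ne h.ne⟩

theorem derivedEquiv_commEdge {p q : X} (h : p < q) :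
    (derivedEquiv X (of (commEdge h)) : FreeGroup X) = comm (of p) (of q) := by
  have : (derivedEquiv X (of (commEdge h)) : FreeGroup X) =
      (tr (single p 1 + single q 1))⁻¹ * of p * tr (single q 1) :=
    gen_of _
  rw [this, add_comm, tr_single_add (by simp [h])]
  simp [tr_single, comm]

theorem commEdge_inj {p q p' q' : X} {h : p < q} {h' : p' < q'} (e : commEdge h = commEdge h') :
    p = p' ∧ q = q' := by
  have e' := Subtype.ext_iff.1 e
  simp only [commEdge, Prod.mk.injEq] at e'
  exact ⟨e'.2, Finsupp.single_left_injective one_ne_zero e'.1⟩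

end Transversal

/-- The order of the alphabet is the lexicographic order of these codes. -/
def code : Letter → List ℕ
  | .x i w => 0 :: i :: w.map Bool.toNat
  | .y i => [1, i]

theorem code_injective : Function.Injective code := by
  have : Function.Injective Bool.toNat := by decide
  rintro (⟨i, w⟩ | i) (⟨j, v⟩ | j) h <;> simp_all [code, List.map_inj_right]

noncomputable instance : LinearOrder Letter := LinearOrder.lift' code code_injective

instance : Countable Letter := code_injective.countable

theorem letter_lt (i : ℕ) (w : List Bool) :
    Letter.x i (w ++ [false]) < Letter.x i (w ++ [true]) := by
  change code _ < code _
  simp only [code, List.map_append, List.map_cons, List.map_nil, Bool.toNat_false, Bool.toNat_true]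
  refine List.cons_lt_cons_iff.2 (Or.inr ⟨rfl, List.cons_lt_cons_iff.2 (Or.inr ⟨rfl, ?_⟩)⟩)
  induction w with
  | nil => decide
  | cons b w ih => exact List.cons_lt_cons_iff.2 (Or.inr ⟨rfl, ih⟩)

theorem y_zero_lt (i : ℕ) : Letter.y 0 < Letter.y (i + 1) := by
  change code _ < code _
  exact List.cons_lt_cons_iff.2 (Or.inr ⟨rfl, List.cons_lt_cons_iff.2 (Or.inl (by omega))⟩)

/-- An injection into a countable set whose range has infinite complement extends to a bijection
from the disjoint union of the source with a countably infinite set. -/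
theorem exists_equiv_extending {A B : Type*} [Countable B] (f : A → B) (hf : Function.Injective f)
    (hinf : (Set.range f)ᶜ.Infinite) : ∃ e : A ⊕ ℕ ≃ B, ∀ a, e (Sum.inl a) = f a := by
  classical
  have : Infinite ((Set.range f)ᶜ : Set B) := hinf.to_subtype
  obtain ⟨c⟩ := nonempty_equiv_of_countable (α := ℕ) (β := ((Set.range f)ᶜ : Set B))
  exact ⟨(Equiv.sumCongr (Equiv.ofInjective f hf) c).trans (Equiv.Set.sumCompl _), fun a => by simp⟩

/-- The letters `x i w` and `y i` as a disjoint union. -/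
def letterEquiv : Letter ≃ (ℕ × List Bool) ⊕ ℕ where
  toFun
    | .x i w => .inl (i, w)
    | .y i => .inr i
  invFun
    | .inl (i, w) => .x i w
    | .inr i => .y i
  left_inv := by rintro (_ | _) <;> rfl
  right_inv := by rintro (⟨_, _⟩ | _) <;> rfl

end Schreier

open Schreier in
theorem exists_splitsLetters : ∃ h : F ≃* commutator F, SplitsLetters h := by
  have : Countable (Edge Letter) := by unfold Edge; infer_instance
  obtain ⟨e, he⟩ := exists_equiv_extending
    (fun p : ℕ × List Bool => commEdge (letter_lt p.1 p.2))
    (fun p q h => by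
      have := (commEdge_inj h).1
      simp only [Letter.x.injEq, List.append_cancel_right_eq] at this
      exact Prod.ext this.1 this.2)
    (by
      -- The basis elements `[y_0, y_{i+1}]` are not among those assigned to the letters `x i w`.
      refine Set.infinite_of_injective_forall_mem (f := fun i : ℕ => commEdge (y_zero_lt i)) ?_ ?_
      · intro i j h
        simpa using (commEdge_inj h).2
      · rintro i ⟨p, hp⟩
        exact absurd (commEdge_inj hp).1 (by simp))
  refine ⟨(FreeGroup.freeGroupCongr (letterEquiv.trans e)).trans (derivedEquiv Letter), ?_⟩
  intro i w
  have h1 : letterEquiv (.x i w) = .inl (i, w) := rfl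
  simp [h1, he, derivedEquiv_commEdge]

/-! ### Congruence subgroups of filtered rings -/

section Congruence

variable {G R : Type*} [Group G] [Ring R]

/-- For a representation `f` of a group in a ring and an additive subgroup `P` of the ring that is
closed under multiplication, the elements `g` for which `f g` and `f g⁻¹` are congruent to `1`
modulo `P`. -/
def congruence (f : G →* R) (P : Submodule ℤ R) (hP : P * P ≤ P) : Subgroup G where
  carrier := {g | f g - 1 ∈ P ∧ f g⁻¹ - 1 ∈ P}
  one_mem' := by simp
  mul_mem' := by
    have key : ∀ a b, f a - 1 ∈ P → f b - 1 ∈ P → f (a * b) - 1 ∈ P := by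
      intro a b ha hb
      have : f (a * b) - 1 = (f a - 1) * (f b - 1) + (f a - 1) + (f b - 1) := by
        rw [map_mul]; noncomm_ring
      rw [this]
      exact add_mem (add_mem (hP (Submodule.mul_mem_mul ha hb)) ha) hb
    rintro a b ⟨ha, ha'⟩ ⟨hb, hb'⟩
    refine ⟨key a b ha hb, ?_⟩
    rw [mul_inv_rev]
    exact key _ _ hb' ha'
  inv_mem' := by
    rintro a ⟨ha, ha'⟩
    exact ⟨ha', by rwa [inv_inv]⟩

/-- If `C` contains `P * Q` and `Q * P` and absorbs multiplication by `P` and `Q` on the right, then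
commutators of elements congruent to `1` modulo `P` and modulo `Q` are congruent to `1` modulo `C`:
with `f g = 1 + a` and `f g' = 1 + b`, the image of the commutator differs from `1` by
`(a * b - b * a) * f (g⁻¹ * g'⁻¹)`. -/
theorem commutator_congruence_le (f : G →* R) {P Q C : Submodule ℤ R} (hP : P * P ≤ P)
    (hQ : Q * Q ≤ Q) (hC : C * C ≤ C) (hPQ : P * Q ≤ C) (hQP : Q * P ≤ C) (hCP : C * P ≤ C)
    (hCQ : C * Q ≤ C) :
    ⁅congruence f P hP, congruence f Q hQ⁆ ≤ congruence f C hC := by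
  have key : ∀ a b, a ∈ congruence f P hP → b ∈ congruence f Q hQ →
      f (a * b) - f (b * a) ∈ C := by
    rintro a b ⟨ha, -⟩ ⟨hb, -⟩
    have : f (a * b) - f (b * a) = (f a - 1) * (f b - 1) - (f b - 1) * (f a - 1) := by
      rw [map_mul, map_mul]; noncomm_ring
    rw [this]
    exact sub_mem (hPQ (Submodule.mul_mem_mul ha hb)) (hQP (Submodule.mul_mem_mul hb ha))
  have absorbP : ∀ c a, c ∈ C → a ∈ congruence f P hP → c * f a ∈ C := by
    rintro c a hc ⟨ha, -⟩
    have : c * f a = c * (f a - 1) + c := by noncomm_ring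
    rw [this]
    exact add_mem (hCP (Submodule.mul_mem_mul hc ha)) hc
  have absorbQ : ∀ c b, c ∈ C → b ∈ congruence f Q hQ → c * f b ∈ C := by
    rintro c b hc ⟨hb, -⟩
    have : c * f b = c * (f b - 1) + c := by noncomm_ring
    rw [this]
    exact add_mem (hCQ (Submodule.mul_mem_mul hc hb)) hc
  rw [Subgroup.commutator_le]
  intro a ha b hb
  have hab := key a b ha hb
  have one : ∀ g : G, f g * f g⁻¹ = 1 := fun g => by rw [← map_mul, mul_inv_cancel, map_one]
  constructor
  · have : f ⁅a, b⁆ - 1 = (f (a * b) - f (b * a)) * f a⁻¹ * f b⁻¹ := by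
      rw [sub_mul, sub_mul, ← map_mul, ← map_mul, ← map_mul, ← map_mul, commutatorElement_def]
      congr 1
      rw [mul_inv_cancel_right, mul_inv_cancel, map_one]
    rw [this]
    exact absorbQ _ _ (absorbP _ _ hab (inv_mem ha)) (inv_mem hb)
  · have : f ⁅a, b⁆⁻¹ - 1 = -((f (a * b) - f (b * a)) * f b⁻¹ * f a⁻¹) := by
      rw [sub_mul, sub_mul, ← map_mul, ← map_mul, ← map_mul, ← map_mul, commutatorElement_inv,
        commutatorElement_def, neg_sub]
      congr 1
      rw [mul_inv_cancel_right, mul_inv_cancel, map_one]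
    rw [this]
    exact neg_mem (absorbP _ _ (absorbQ _ _ hab (inv_mem hb)) (inv_mem ha))

end Congruence

/-! ### Unitriangular matrices -/

section Matrices

variable (m : ℕ)

/-- Square matrices of size `m + 1`, with rows and columns numbered from `0` to `m`. -/
abbrev Mat : Type := Matrix (Fin (m + 1)) (Fin (m + 1)) ℤ

/-- The matrices whose entries vanish below the `c`-th superdiagonal. -/
def upper (c : ℕ) : Submodule ℤ (Mat m) where
  carrier := {M | ∀ i j, j.val < i.val + c → M i j = 0}
  zero_mem' := fun _ _ _ => rfl
  add_mem' := fun hM hN i j h => by simp [hM i j h, hN i j h]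
  smul_mem' := fun r M hM i j h => by simp [hM i j h]

variable {m}

theorem upper_mul (a b : ℕ) : upper m a * upper m b ≤ upper m (a + b) := by
  rw [Submodule.mul_le]
  intro M hM N hN i j h
  rw [Matrix.mul_apply]
  refine Finset.sum_eq_zero fun l _ => ?_
  by_cases hl : l.val < i.val + a
  · rw [hM i l hl, zero_mul]
  · rw [hN l j (by omega), mul_zero]

theorem upper_antitone : Antitone (upper m) :=
  fun _ _ hab _ hM i j h => hM i j (by omega)

theorem upper_mul_self (a : ℕ) : upper m a * upper m a ≤ upper m a :=
  (upper_mul a a).trans (upper_antitone (by omega))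

theorem eq_zero_of_mem_upper {M : Mat m} (hM : M ∈ upper m (m + 1)) : M = 0 := by
  ext i j
  exact hM i j (by omega)

variable (m) in
/-- The matrix unit with entry `1` in row `a` and column `b`; zero if `a` or `b` exceeds `m`. -/
def unitMat (a b : ℕ) : Mat m := Matrix.of fun i j => if i.val = a ∧ j.val = b then 1 else 0

theorem unitMat_mul {a b c : ℕ} (hb : b ≤ m) : unitMat m a b * unitMat m b c = unitMat m a c := by
  ext i j
  rw [Matrix.mul_apply, Finset.sum_eq_single ⟨b, by omega⟩]
  · by_cases h1 : i.val = a <;> by_cases h2 : j.val = c <;> simp [unitMat, h1, h2]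
  · intro l _ hl
    have : l.val ≠ b := fun h => hl (Fin.ext h)
    simp [unitMat, this]
  · simp

theorem unitMat_mul_of_ne {a b c d : ℕ} (h : b ≠ c) : unitMat m a b * unitMat m c d = 0 := by
  ext i j
  rw [Matrix.mul_apply]
  refine Finset.sum_eq_zero fun l _ => ?_
  by_cases hl : l.val = b
  · simp [unitMat, hl, h]
  · simp [unitMat, hl]

theorem unitMat_mem_upper {a b c : ℕ} (hab : a + c ≤ b) : unitMat m a b ∈ upper m c := by
  intro i j h
  refine if_neg ?_
  omega

theorem unitMat_ne_zero {a b : ℕ} (ha : a ≤ m) (hb : b ≤ m) : unitMat m a b ≠ 0 := by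
  intro h
  have := congrFun (congrFun h ⟨a, by omega⟩) ⟨b, by omega⟩
  simp [unitMat] at this

variable (m) in
/-- The elementary matrix `1 + E_{a,a+1}`. -/
def elem (a : ℕ) : (Mat m)ˣ where
  val := 1 + unitMat m a (a + 1)
  inv := 1 - unitMat m a (a + 1)
  val_inv := by
    have := unitMat_mul_of_ne (m := m) (a := a) (d := a + 1) (Nat.succ_ne_self a)
    simp [mul_sub, add_mul, this]
  inv_val := by
    have := unitMat_mul_of_ne (m := m) (a := a) (d := a + 1) (Nat.succ_ne_self a)
    simp [mul_add, sub_mul, this]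

/-- The commutator of `1 + E_{a,b}` and `1 + E_{b,c}` is `1 + E_{a,c}`. -/
theorem val_comm {a b c : ℕ} (hab : a < b) (hbc : b < c) (hb : b ≤ m) {u v : (Mat m)ˣ}
    (hu : (u : Mat m) = 1 + unitMat m a b) (hv : (v : Mat m) = 1 + unitMat m b c) :
    ((comm u v : (Mat m)ˣ) : Mat m) = 1 + unitMat m a c := by
  have h : (v * u : Mat m) * (1 + unitMat m a c) = u * v := by
    rw [hu, hv]
    simp only [mul_add, add_mul, one_mul, mul_one, unitMat_mul hb,
      unitMat_mul_of_ne (show b ≠ a by omega), unitMat_mul_of_ne (show c ≠ a by omega), zero_mul]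
    abel
  have h' : comm u v = (v * u)⁻¹ * (u * v) := by rw [comm]; group
  rw [h', Units.val_mul, Units.val_mul u v, ← h, ← Units.val_mul v u, Units.inv_mul_cancel_left]

end Matrices

/-! ### The matrix representation of the free group -/

/-- The number with binary digits `w`, the most significant digit first. -/
def binary (w : List Bool) : ℕ := w.foldl (fun n b => 2 * n + b.toNat) 0

theorem binary_append (w : List Bool) (b : Bool) : binary (w ++ [b]) = 2 * binary w + b.toNat := by
  simp [binary, List.foldl_append]

theorem binary_lt (w : List Bool) : binary w < 2 ^ w.length := by
  induction w using List.reverseRecOn with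
  | nil => simp [binary]
  | append_singleton w b ih =>
    rw [binary_append, List.length_append, List.length_singleton, pow_succ]
    have := b.toNat_le
    omega

/-- The representation of the free group in which the letters `x i w` with `w` of length `k` become
the elementary matrices next to the diagonal, ordered by `i` and then by `w`; all other letters act
trivially. -/
def rep (m k : ℕ) : F →* (Mat m)ˣ :=
  FreeGroup.lift fun
    | .x i w => if w.length = k then
        elem m (i * 2 ^ k + binary w) else 1
    | .y _ => 1

/-- The representation `rep` as a homomorphism to the multiplicative monoid of all matrices. -/
def matRep (m k : ℕ) : F →* Mat m := (Units.coeHom _).comp (rep m k)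

theorem map_comm {G H : Type*} [Group G] [Group H] (f : G →* H) (a b : G) :
    f (comm a b) = comm (f a) (f b) := by simp [comm]

section Endomorphism

variable {h : F ≃* commutator F}

/-- The embedding `F → F` given by `h`. -/
def emb (h : F ≃* commutator F) : F →* F := endo h

/-- The `k`-th iterate of the embedding given by `h`. -/
def iter (h : F ≃* commutator F) (k : ℕ) : F →* F := endo h ^ k

theorem iter_zero (u : F) : iter h 0 u = u := rfl

theorem iter_succ (k : ℕ) (u : F) : iter h (k + 1) u = iter h k (emb h u) := by
  rw [iter, pow_succ]; rfl

theorem iter_succ' (k : ℕ) (u : F) : iter h (k + 1) u = emb h (iter h k u) := by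
  rw [iter, pow_succ']; rfl

theorem emb_x (hh : SplitsLetters h) (i : ℕ) (w : List Bool) :
    emb h (FreeGroup.of (.x i w)) =
      comm (FreeGroup.of (.x i (w ++ [false]))) (FreeGroup.of (.x i (w ++ [true]))) := hh i w

theorem emb_injective (h : F ≃* commutator F) : Function.Injective (emb h) :=
  Subtype.val_injective.comp h.injective

theorem range_emb (h : F ≃* commutator F) : (emb h).range = commutator F := by
  ext u
  constructor
  · rintro ⟨v, rfl⟩
    exact (h v).2
  · intro hu
    exact ⟨h.symm ⟨u, hu⟩, by simp [emb, endo]⟩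

/-- The `j`-th iterate of `h` turns a letter `x i w` into a balanced commutator of `2 ^ j` letters.
These letters are represented by consecutive elementary matrices, whose commutator is again of the
form `1 + E_{a,b}`. -/
theorem matRep_iter_x (hh : SplitsLetters h) {m k i : ℕ} (him : (i + 1) * 2 ^ k ≤ m)
    (j : ℕ) (w : List Bool) (hw : w.length + j = k) :
    matRep m k (iter h j (FreeGroup.of (.x i w))) =
      1 + unitMat m (i * 2 ^ k + binary w * 2 ^ j) (i * 2 ^ k + (binary w + 1) * 2 ^ j) := by
  induction j generalizing w with
  | zero =>
    rw [add_zero] at hw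
    simp [iter_zero, matRep, rep, hw, elem, add_assoc]
  | succ j ih =>
    have h1 := ih (w ++ [false]) (by simp; omega)
    have h2 := ih (w ++ [true]) (by simp; omega)
    rw [iter_succ, emb_x hh, map_comm]
    change ((rep m k (comm _ _) : (Mat m)ˣ) : Mat m) = _
    rw [map_comm]
    simp only [binary_append, Bool.toNat_false, Bool.toNat_true, add_zero] at h1 h2
    have e1 : i * 2 ^ k + binary w * 2 ^ (j + 1) = i * 2 ^ k + 2 * binary w * 2 ^ j := by ring
    have e2 : i * 2 ^ k + (binary w + 1) * 2 ^ (j + 1) =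
        i * 2 ^ k + (2 * binary w + 1 + 1) * 2 ^ j := by ring
    have hpos : 0 < 2 ^ j := by positivity
    rw [e1, e2]
    refine val_comm (b := i * 2 ^ k + (2 * binary w + 1) * 2 ^ j) ?_ ?_ ?_ h1 h2
    · rw [add_one_mul]; omega
    · rw [add_one_mul (2 * binary w + 1)]; omega
    · have hb : (binary w + 1) * 2 ^ (j + 1) ≤ 2 ^ k := by
        rw [← hw, pow_add 2 w.length]
        exact Nat.mul_le_mul_right _ (binary_lt w)
      have h3 : (2 * binary w + 1) * 2 ^ j ≤ (binary w + 1) * 2 ^ (j + 1) := by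
        rw [pow_succ', ← mul_assoc]
        exact Nat.mul_le_mul_right _ (by omega)
      rw [add_one_mul] at him
      omega

/-- The left associated commutator `[x_0, …, x_j]` of the letters with empty words. -/
def leftComm : ℕ → F
  | 0 => FreeGroup.of (.x 0 [])
  | j + 1 => comm (leftComm j) (FreeGroup.of (.x (j + 1) []))

/-- After `k` iterations of `h`, the letters of `leftComm j` occupy consecutive blocks of `2 ^ k`
positions next to the diagonal, so its image is again of the form `1 + E_{a,b}`. -/
theorem matRep_iter_leftComm (hh : SplitsLetters h) {m k j : ℕ} (hm : (j + 1) * 2 ^ k ≤ m) :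
    matRep m k (iter h k (leftComm j)) = 1 + unitMat m 0 ((j + 1) * 2 ^ k) := by
  have hx : ∀ i, (i + 1) * 2 ^ k ≤ m → matRep m k (iter h k (FreeGroup.of (.x i []))) =
      1 + unitMat m (i * 2 ^ k) ((i + 1) * 2 ^ k) := by
    intro i hi
    rw [matRep_iter_x hh hi k [] (by simp)]
    simp [binary, add_one_mul]
  induction j with
  | zero => simpa [leftComm] using hx 0 hm
  | succ j ih =>
    have hpos : 0 < 2 ^ k := by positivity
    have h3 := add_one_mul (j + 1) (2 ^ k)
    rw [leftComm, map_comm]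
    change ((rep m k (comm _ _) : (Mat m)ˣ) : Mat m) = _
    rw [map_comm]
    exact val_comm (by positivity) (by omega) (by omega) (ih (by omega)) (hx _ hm)

/-- The image of the `k`-th iterate of `h` is the `k`-th derived subgroup. -/
theorem range_iter (h : F ≃* commutator F) (k : ℕ) : (iter h k).range = derivedSeries F k := by
  induction k with
  | zero => rw [derivedSeries_zero]; exact MonoidHom.range_eq_top.2 fun x => ⟨x, rfl⟩
  | succ k ih =>
    have h2 : (iter h (k + 1)).range = (iter h k).range.map (emb h) := by
      rw [MonoidHom.map_range]
      exact congrArg _ (MonoidHom.ext (iter_succ' k))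
    rw [h2, ih]
    clear h2 ih
    induction k with
    | zero => rw [derivedSeries_zero, ← MonoidHom.range_eq_map, range_emb, derivedSeries_one]
    | succ k ih => rw [derivedSeries_succ, Subgroup.map_commutator, ih, ← derivedSeries_succ]

end Endomorphism

/-- The letters are congruent to `1` modulo the first superdiagonal, and each derivation doubles the
number of the superdiagonal. -/
theorem derivedSeries_le_congruence (m k c : ℕ) :
    derivedSeries F c ≤ congruence (matRep m k) (upper m (2 ^ c)) (upper_mul_self _) := by
  induction c with
  | zero =>
    rintro u -
    rw [pow_zero]
    induction u using FreeGroup.induction_on with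
    | C1 => exact one_mem _
    | of l =>
      rcases l with ⟨i, w⟩ | i
      · by_cases hw : w.length = k
        · have hmem := unitMat_mem_upper (m := m) (le_refl (i * 2 ^ k + binary w + 1))
          refine ⟨?_, ?_⟩
          · simpa [matRep, rep, hw, elem] using hmem
          · simpa [matRep, rep, hw, elem, Units.inv_mk] using neg_mem hmem
        · refine ⟨?_, ?_⟩ <;> simp [matRep, rep, hw]
      · refine ⟨?_, ?_⟩ <;> simp [matRep, rep]
    | inv_of l hl => exact inv_mem hl
    | mul u v hu hv => exact mul_mem hu hv
  | succ c ih =>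
    rw [derivedSeries_succ]
    refine (Subgroup.commutator_mono ih ih).trans (commutator_congruence_le _ _ _ _ ?_ ?_ ?_ ?_) <;>
    refine (upper_mul _ _).trans (upper_antitone ?_) <;>
    rw [pow_succ] <;> omega

/-! ### Subgroups of a cube of groups -/

section Cube

variable {d : ℕ} {ι : Type*} (e : ι ≃ Finset (Fin d))

/-- The element that equals `g` at the vertices of the cube `ι` that contain `α`, and `1` at the
other vertices. The bijection `e` identifies the vertices with the subsets of `{0, …, d - 1}`. -/
def face {G : Type*} [Group G] (α : Finset (Fin d)) : G →* (ι → G) where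
  toFun g v := if α ⊆ e v then g else 1
  map_one' := by ext; simp
  map_mul' a b := by ext v; by_cases h : α ⊆ e v <;> simp [h]

theorem face_apply {G : Type*} [Group G] (α : Finset (Fin d)) (g : G) (v : ι) :
    face e α g v = if α ⊆ e v then g else 1 := rfl

theorem commutator_face {G : Type*} [Group G] (α β : Finset (Fin d)) (a b : G) :
    ⁅face e α a, face e β b⁆ = face e (α ∪ β) ⁅a, b⁆ := by
  ext v
  by_cases hα : α ⊆ e v <;> by_cases hβ : β ⊆ e v <;>
    simp [commutatorElement_def, face_apply, Finset.union_subset_iff, hα, hβ]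

/-- The subgroup of the cube of `G` generated by the diagonal copy of `M` and by the copies of `N`
on the faces given by one element of `{0, …, d - 1}`. -/
def cube {G : Type*} [Group G] (M N : Subgroup G) : Subgroup (ι → G) :=
  M.map (face e ∅) ⊔ ⨆ i, N.map (face e {i})

theorem map_face_le_cube {G : Type*} [Group G] (M N : Subgroup G) (i : Fin d) :
    N.map (face e {i}) ≤ cube e M N :=
  le_sup_of_le_right (le_iSup_of_le i le_rfl)

theorem map_cube {G H : Type*} [Group G] [Group H] (f : G →* H) (M N : Subgroup G) :
    (cube e M N).map (f.compLeft ι) = cube e (M.map f) (N.map f) := by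
  have h : ∀ α, (f.compLeft ι).comp (face e α) = (face e α).comp f := by
    intro α
    ext g v
    simp only [MonoidHom.comp_apply, MonoidHom.compLeft_apply, Function.comp_apply, face_apply,
      apply_ite f, map_one]
  simp only [cube, Subgroup.map_sup, Subgroup.map_iSup, Subgroup.map_map, h]

theorem cube_mono {G : Type*} [Group G] {M M' : Subgroup G} (hM : M ≤ M') (N : Subgroup G) :
    cube e M N ≤ cube e M' N :=
  sup_le_sup (Subgroup.map_mono hM) le_rfl

theorem map_face_empty_le_cube {G : Type*} [Group G] (M N : Subgroup G) :
    M.map (face e ∅) ≤ cube e M N :=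
  le_sup_left

theorem isSubdirect_cube {G : Type*} [Group G] (N : Subgroup G) :
    IsSubdirect (cube e (⊤ : Subgroup G) N) := by
  intro i g
  refine ⟨face e ∅ g, map_face_empty_le_cube e _ _ ⟨g, trivial, rfl⟩, ?_⟩
  simp [face_apply]

/-- The first `j` elements of `{0, …, d - 1}`. -/
def initial (d j : ℕ) : Finset (Fin d) := Finset.univ.filter fun i => i.val < j

theorem initial_succ {j : ℕ} (hj : j < d) : initial d (j + 1) = initial d j ∪ {⟨j, hj⟩} := by
  ext i
  simp only [initial, Finset.mem_filter, Finset.mem_univ, true_and, Finset.mem_union,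
    Finset.mem_singleton, Fin.ext_iff]
  omega

/-- Taking commutators with `N` on a new face each time moves a subgroup to smaller and smaller
faces. -/
theorem map_face_commutator_le {G : Type*} [Group G] {M N P : Subgroup G} {j : ℕ} (hj : j < d)
    {L : Subgroup (ι → G)} (h : P.map (face e (initial d j)) ≤ L) :
    (⁅P, N⁆).map (face e (initial d (j + 1))) ≤ ⁅L, cube e M N⁆ := by
  rw [Subgroup.map_le_iff_le_comap, Subgroup.commutator_le]
  intro a ha b hb
  rw [Subgroup.mem_comap, initial_succ hj, ← commutator_face]
  exact Subgroup.commutator_mem_commutator (h ⟨a, ha, rfl⟩) (map_face_le_cube e M N _ ⟨b, hb, rfl⟩)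

theorem map_face_relComm_le {G : Type*} [Group G] (N : Subgroup G) {j : ℕ} (hj : j ≤ d) :
    (relComm N j).map (face e (initial d j)) ≤ (cube e ⊤ N).lowerCentralSeries j := by
  induction j with
  | zero =>
    have : initial d 0 = ∅ := by simp [initial]
    rw [this]
    exact le_sup_left
  | succ j ih => exact map_face_commutator_le e hj (ih (by omega))

theorem map_face_lowerCentralSeries_le {G : Type*} [Group G] (N : Subgroup G) {j : ℕ} (hj : j < d) :
    (N.lowerCentralSeries j).map (face e (initial d (j + 1))) ≤
      (cube e ⊤ N).lowerCentralSeries j := by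
  induction j with
  | zero =>
    have : initial d 1 = {⟨0, hj⟩} := by rw [initial_succ hj]; simp [initial]
    rw [this]
    exact map_face_le_cube e _ _ _
  | succ j ih => exact map_face_commutator_le e hj (ih (by omega))

end Cube

/-! ### A filtration of the ring of matrix-valued functions on a cube -/

section Filtration

variable {d : ℕ} {ι : Type*} (e : ι ≃ Finset (Fin d)) {m : ℕ}

/-- The function that equals `r` at the vertices of the cube that contain `α`, and `0` at the other
vertices. -/
def faceMat (α : Finset (Fin d)) (r : Mat m) : ι → Mat m := fun v => if α ⊆ e v then r else 0

theorem faceMat_mul (α β : Finset (Fin d)) (r s : Mat m) :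
    faceMat e α r * faceMat e β s = faceMat e (α ∪ β) (r * s) := by
  ext1 v
  by_cases hα : α ⊆ e v <;> by_cases hβ : β ⊆ e v <;>
    simp [faceMat, Finset.union_subset_iff, hα, hβ]

/-- The weight required of a matrix on the face of `α` in the `c`-th term of the filtration. Every
element of `α` costs `n`, and a face of codimension less than `c` costs `1` more. -/
def weight (n c : ℕ) (α : Finset (Fin d)) : ℕ := n * α.card + if α.card < c then 1 else 0

/-- If `α` and `β` overlap, then the union saves the cost of a common element, which pays for the
possible extra `1`; if they are disjoint and `β` is nonempty, the codimension grows. -/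
theorem weight_union_le {n : ℕ} (hn : 1 ≤ n) (c : ℕ) (α β : Finset (Fin d)) :
    weight n (c + 1) (α ∪ β) ≤ weight n c α + weight n 1 β := by
  unfold weight
  have h1 := Finset.card_union_add_card_inter α β
  have h2 := congrArg (n * ·) h1
  simp only [mul_add] at h2
  rcases Nat.eq_zero_or_pos (α ∩ β).card with h0 | h0
  · rw [h0] at h1 h2
    split_ifs <;> omega
  · have h3 : n * 1 ≤ n * (α ∩ β).card := Nat.mul_le_mul_left n h0
    split_ifs <;> omega

/-- The `c`-th term of the filtration, spanned by matrices on faces of sufficient weight. -/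
def filt (m n c : ℕ) : Submodule ℤ (ι → Mat m) :=
  Submodule.span ℤ {f | ∃ α, ∃ r ∈ upper m (weight n c α), faceMat e α r = f}

theorem faceMat_mem_filt {n c : ℕ} {α : Finset (Fin d)} {r : Mat m}
    (hr : r ∈ upper m (weight n c α)) : faceMat e α r ∈ filt e m n c :=
  Submodule.subset_span ⟨α, r, hr, rfl⟩

theorem filt_mul {n : ℕ} (hn : 1 ≤ n) (c : ℕ) :
    filt e m n c * filt e m n 1 ≤ filt e m n (c + 1) := by
  rw [filt, filt, Submodule.span_mul_span, Submodule.span_le]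
  rintro _ ⟨_, ⟨α, r, hr, rfl⟩, _, ⟨β, s, hs, rfl⟩, rfl⟩
  simp only [faceMat_mul]
  exact faceMat_mem_filt e (upper_antitone (weight_union_le hn c α β)
    (upper_mul _ _ (Submodule.mul_mem_mul hr hs)))

theorem mul_filt {n : ℕ} (hn : 1 ≤ n) (c : ℕ) :
    filt e m n 1 * filt e m n c ≤ filt e m n (c + 1) := by
  rw [filt, filt, Submodule.span_mul_span, Submodule.span_le]
  rintro _ ⟨_, ⟨α, r, hr, rfl⟩, _, ⟨β, s, hs, rfl⟩, rfl⟩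
  simp only [faceMat_mul]
  refine faceMat_mem_filt e (upper_antitone ?_ (upper_mul _ _ (Submodule.mul_mem_mul hr hs)))
  rw [Finset.union_comm, add_comm (weight n 1 α)]
  exact weight_union_le hn c β α

theorem filt_antitone (n : ℕ) : Antitone (filt e m n) := by
  intro c c' h
  rw [filt, Submodule.span_le]
  rintro _ ⟨α, r, hr, rfl⟩
  refine faceMat_mem_filt e (upper_antitone ?_ hr)
  unfold weight
  split_ifs <;> omega

theorem filt_mul_self {n : ℕ} (hn : 1 ≤ n) (c : ℕ) :
    filt e m n (c + 1) * filt e m n (c + 1) ≤ filt e m n (c + 1) :=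
  (mul_le_mul_right (filt_antitone e n (by omega : 1 ≤ c + 1)) _).trans
    ((filt_mul e hn _).trans (filt_antitone e n (by omega)))

/-- Elements of the `(d + 1)`-st term have vanishing alternating sum over the vertices: a matrix on
a face of positive dimension cancels out, and on the remaining face, a single vertex, the weight
leaves only zero. -/
theorem alternating_sum_eq_zero [Fintype ι] {n : ℕ} {f : ι → Mat (d * n)}
    (hf : f ∈ filt e (d * n) n (d + 1)) : ∑ v, (-1 : ℤ) ^ (e v).card • f v = 0 := by
  induction hf using Submodule.span_induction with
  | mem f hf =>
    obtain ⟨α, r, hr, rfl⟩ := hf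
    by_cases hα : α = Finset.univ
    · have : r = 0 := by
        refine eq_zero_of_mem_upper ?_
        rw [hα, weight, Finset.card_univ, Fintype.card_fin, if_pos (by omega), mul_comm n] at hr
        exact hr
      simp [faceMat, this]
    · obtain ⟨i, hi⟩ : ∃ i, i ∉ α := by
        by_contra! h
        exact hα (Finset.eq_univ_iff_forall.2 h)
      rw [← e.symm.sum_comp]
      simp only [faceMat, Equiv.apply_symm_apply]
      -- The vertices `t` and `insert i t`, for `i ∉ α`, cancel each other.
      rw [← Finset.powerset_univ, ← Finset.insert_erase (Finset.mem_univ i),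
        Finset.sum_powerset_insert (Finset.notMem_erase i _), ← Finset.sum_add_distrib]
      refine Finset.sum_eq_zero fun t ht => ?_
      have hit : i ∉ t := fun h => Finset.notMem_erase i _ (Finset.mem_powerset.1 ht h)
      simp only [Finset.card_insert_of_notMem hit, Finset.subset_insert_iff_of_notMem hi, pow_succ]
      split_ifs <;> simp
  | zero => simp
  | add f g _ _ hf hg =>
    simp only [Pi.add_apply, smul_add, Finset.sum_add_distrib, hf, hg, add_zero]
  | smul a f _ hf =>
    simp only [Pi.smul_apply, smul_comm _ a, ← Finset.smul_sum, hf, smul_zero]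

end Filtration

/-! ### The lower central series at a finite stage -/

section Stage

variable {d : ℕ} {ι : Type*} (e : ι ≃ Finset (Fin d))

theorem map_face_le_congruence (m k : ℕ) {n c : ℕ} {α : Finset (Fin d)} {D : Subgroup F}
    (hP : filt e m n c * filt e m n c ≤ filt e m n c)
    (hD : D ≤ congruence (matRep m k) (upper m (weight n c α)) (upper_mul_self _)) :
    D.map (face e α) ≤ congruence ((matRep m k).compLeft ι) (filt e m n c) hP := by
  have key : ∀ g, ((matRep m k).compLeft ι) (face e α g) - 1 = faceMat e α (matRep m k g - 1) := by
    intro g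
    ext1 v
    by_cases h : α ⊆ e v <;> simp [face_apply, faceMat, h]
  rintro _ ⟨g, hg, rfl⟩
  obtain ⟨h1, h2⟩ := hD hg
  refine ⟨?_, ?_⟩
  · rw [key]
    exact faceMat_mem_filt e h1
  · rw [← map_inv, key]
    exact faceMat_mem_filt e h2

theorem cube_le_congruence (m k : ℕ) :
    cube e ⊤ (derivedSeries F k) ≤ congruence ((matRep m k).compLeft ι) (filt e m (2 ^ k) 1)
      (filt_mul_self e Nat.one_le_two_pow 0) := by
  refine sup_le (map_face_le_congruence e m k _ ?_)
    (iSup_le fun i => map_face_le_congruence e m k _ ?_)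
  · simpa [weight] using derivedSeries_le_congruence m k 0
  · simpa [weight] using derivedSeries_le_congruence m k k

theorem lowerCentralSeries_cube_le_congruence (m k c : ℕ) :
    (cube e ⊤ (derivedSeries F k)).lowerCentralSeries c ≤
      congruence ((matRep m k).compLeft ι) (filt e m (2 ^ k) (c + 1))
        (filt_mul_self e Nat.one_le_two_pow c) := by
  have hn : 1 ≤ 2 ^ k := Nat.one_le_two_pow
  induction c with
  | zero => exact cube_le_congruence e m k
  | succ c ih =>
    rw [Subgroup.lowerCentralSeries_succ]
    refine (Subgroup.commutator_mono ih (cube_le_congruence e m k)).trans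
      (commutator_congruence_le _ _ _ _ (filt_mul e hn _) (mul_filt e hn _) ?_
        ((filt_mul e hn _).trans (filt_antitone e _ (by omega))))
    exact (mul_le_mul_right (filt_antitone e _ (by omega : 1 ≤ c + 1)) _).trans
      ((filt_mul e hn _).trans (filt_antitone e _ (by omega)))

/-- The alternating sum for this element is `± E_{0,m}` with `m = (j + 1) * 2 ^ k`. -/
theorem face_leftComm_notMem [Fintype ι] {h : F ≃* commutator F} (hh : SplitsLetters h) {j : ℕ}
    (e : ι ≃ Finset (Fin (j + 1))) (k : ℕ) :
    face e Finset.univ (iter h k (leftComm j)) ∉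
      (cube e ⊤ (derivedSeries F k)).lowerCentralSeries (j + 1) := by
  intro hmem
  have h1 := alternating_sum_eq_zero e
    (lowerCentralSeries_cube_le_congruence e ((j + 1) * 2 ^ k) k (j + 1) hmem).1
  rw [Finset.sum_eq_single (e.symm Finset.univ)] at h1
  · simp only [Pi.sub_apply, Pi.one_apply, MonoidHom.compLeft_apply, Function.comp_apply,
      face_apply, Equiv.apply_symm_apply, Finset.Subset.refl, if_true, matRep_iter_leftComm hh le_rfl,
      add_sub_cancel_left] at h1
    refine unitMat_ne_zero (Nat.zero_le _) le_rfl ((smul_eq_zero_iff_right ?_).1 h1)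
    exact pow_ne_zero _ (by norm_num)
  · intro v _ hv
    have : ¬ Finset.univ ⊆ e v := fun h' => hv (by
      rw [Equiv.eq_symm_apply]; exact Finset.univ_subset_iff.1 h')
    simp [face_apply, this]
  · simp

end Stage

/-! ### The direct limit -/

section DirectLimit

variable (h : F ≃* commutator F)

theorem iter_injective (k : ℕ) : Function.Injective (iter h k) := by
  induction k with
  | zero => exact fun _ _ e => e
  | succ k ih =>
    intro a b e
    rw [iter_succ, iter_succ] at e
    exact emb_injective h (ih e)

theorem toLimit_injective (k : ℕ) : Function.Injective (toLimit h k) :=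
  DirectLimit.mk_injective (f := transition h) (fun i j _ => iter_injective h (j - i)) k

theorem exists_toLimit_eq (z : Limit h) : ∃ k u, toLimit h k u = z := by
  obtain ⟨k, u, rfl⟩ := DirectLimit.exists_eq_mk _ z
  exact ⟨k, u, rfl⟩

theorem toLimit_iter (k : ℕ) (u : F) : toLimit h k (iter h k u) = toLimit h 0 u := by
  rw [← Nat.sub_zero k]
  exact DirectLimit.mk_apply (f := transition h) 0 k u (Nat.zero_le k)

theorem toLimit_emb (k : ℕ) (u : F) : toLimit h (k + 1) (emb h u) = toLimit h k u := by
  have : iter h (k + 1 - k) u = emb h u := by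
    rw [Nat.add_sub_cancel_left, iter_succ', iter_zero]
  rw [← this]
  exact DirectLimit.mk_apply (f := transition h) k (k + 1) u (Nat.le_succ k)

theorem range_toLimit_mono : Monotone fun k => (toLimit h k).range := by
  refine monotone_nat_of_le_succ fun k => ?_
  rintro _ ⟨u, rfl⟩
  exact ⟨emb h u, toLimit_emb h k u⟩

/-- Seen from the `k`-th copy of `F`, the first copy is the `k`-th derived subgroup. -/
theorem map_toLimit_derivedSeries (k : ℕ) :
    (derivedSeries F k).map (toLimit h k) = firstCopy h := by
  rw [← range_iter h k, MonoidHom.map_range]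
  exact congrArg _ (MonoidHom.ext (toLimit_iter h k))

theorem infinite_limit : Infinite (Limit h) := by
  have : Infinite F := Infinite.of_injective (fun i => FreeGroup.of (Letter.y i))
    fun i j e => by simpa using FreeGroup.of_injective e
  exact Infinite.of_injective _ (toLimit_injective h 0)

theorem isPerfect_limit : Group.IsPerfect (Limit h) where
  commutator_eq_top := by
    rw [eq_top_iff]
    rintro z -
    obtain ⟨k, u, rfl⟩ := exists_toLimit_eq h z
    have hu : emb h u ∈ commutator F := range_emb h ▸ ⟨u, rfl⟩
    rw [← toLimit_emb, commutator_def]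
    have hmem := Subgroup.mem_map_of_mem (toLimit h (k + 1)) hu
    rw [commutator_def, Subgroup.map_commutator] at hmem
    exact Subgroup.commutator_mono le_top le_top hmem

theorem normal_firstCopy : (firstCopy h).Normal := by
  refine ⟨fun n hn g => ?_⟩
  obtain ⟨k, u, rfl⟩ := exists_toLimit_eq h g
  rw [← map_toLimit_derivedSeries h k] at hn ⊢
  obtain ⟨v, hv, rfl⟩ := hn
  exact ⟨u * v * u⁻¹, (derivedSeries_normal F k).conj_mem v hv u, by simp⟩

/-- The lower central series of the union of an ascending chain of subgroups is the union of the
lower central series. -/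
theorem lowerCentralSeries_iSup_le {G : Type*} [Group G] {T : ℕ → Subgroup G} (hT : Monotone T)
    (c : ℕ) : (⨆ k, T k).lowerCentralSeries c ≤ ⨆ k, (T k).lowerCentralSeries c := by
  induction c with
  | zero => exact le_rfl
  | succ c ih =>
    have hmono : ∀ c, Monotone fun k => (T k).lowerCentralSeries c :=
      fun c => (Subgroup.lowerCentralSeries_mono c).comp hT
    rw [Subgroup.lowerCentralSeries_succ, Subgroup.commutator_le]
    intro a ha b hb
    obtain ⟨i, hi⟩ := (Subgroup.mem_iSup_of_directed (hmono c).directed_le).1 (ih ha)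
    obtain ⟨j, hj⟩ := (Subgroup.mem_iSup_of_directed hT.directed_le).1 hb
    exact Subgroup.mem_iSup_of_mem (max i j) (Subgroup.commutator_mem_commutator
      (hmono c (le_max_left i j) hi) (hT (le_max_right i j) hj))

theorem face_toLimit_leftComm_notMem (hh : SplitsLetters h) {ι : Type*} [Fintype ι] {j : ℕ}
    (e : ι ≃ Finset (Fin (j + 1))) :
    face e Finset.univ (toLimit h 0 (leftComm j)) ∉
      (cube e ⊤ (firstCopy h)).lowerCentralSeries (j + 1) := by
  intro hmem
  have hT : Monotone fun k => cube e (toLimit h k).range (firstCopy h) :=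
    fun a b hab => cube_mono e (range_toLimit_mono h hab) _
  have hsup : cube e ⊤ (firstCopy h) ≤ ⨆ k, cube e (toLimit h k).range (firstCopy h) := by
    refine sup_le ?_ (iSup_le fun i => (map_face_le_cube e _ _ i).trans
      (le_iSup (fun k => cube e (toLimit h k).range (firstCopy h)) 0))
    rintro _ ⟨g, -, rfl⟩
    obtain ⟨k, u, rfl⟩ := exists_toLimit_eq h g
    exact Subgroup.mem_iSup_of_mem k (map_face_empty_le_cube e _ _ ⟨_, ⟨u, rfl⟩, rfl⟩)
  obtain ⟨k, hk⟩ := (Subgroup.mem_iSup_of_directed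
    ((Subgroup.lowerCentralSeries_mono (j + 1)).comp hT).directed_le).1
      (lowerCentralSeries_iSup_le hT _ (Subgroup.lowerCentralSeries_mono _ hsup hmem))
  -- In the `k`-th copy of `F`, the subgroup `N` is the `k`-th derived subgroup.
  have hstage : cube e (toLimit h k).range (firstCopy h) =
      (cube e ⊤ (derivedSeries F k)).map ((toLimit h k).compLeft ι) := by
    rw [map_cube, map_toLimit_derivedSeries, MonoidHom.range_eq_map]
  simp only [Function.comp_apply] at hk
  rw [hstage, ← Subgroup.map_lowerCentralSeries] at hk
  obtain ⟨u, hu, hu'⟩ := hk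
  refine face_leftComm_notMem hh e k ?_
  suffices heq : face e Finset.univ (iter h k (leftComm j)) = u from heq ▸ hu
  ext1 v
  refine toLimit_injective h k ?_
  have := congrFun hu' v
  rw [MonoidHom.compLeft_apply, Function.comp_apply] at this
  rw [this, face_apply, face_apply, apply_ite (toLimit h k), toLimit_iter, map_one]

theorem leftComm_mem (j : ℕ) :
    toLimit h 0 (leftComm j) ∈ (firstCopy h).lowerCentralSeries j := by
  induction j with
  | zero => exact ⟨_, rfl⟩
  | succ j ih =>
    have hc : ∀ a b : Limit h, comm a b = ⁅a⁻¹, b⁻¹⁆ := by simp [comm, commutatorElement_def]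
    rw [leftComm, map_comm, hc]
    exact Subgroup.commutator_mem_commutator (inv_mem ih) (inv_mem ⟨_, rfl⟩)

end DirectLimit

theorem relComm_succ_le {G : Type*} [Group G] (N : Subgroup G) [N.Normal] (j : ℕ) :
    relComm N (j + 1) ≤ N.lowerCentralSeries j := by
  induction j with
  | zero => exact Subgroup.commutator_le_right _ _
  | succ j ih => exact Subgroup.commutator_mono ih le_rfl

theorem initial_self (d : ℕ) : initial d d = Finset.univ := by
  ext i
  simp [initial]

theorem relComm_lt_gamma {h : F ≃* commutator F} (hh : SplitsLetters h) {d : ℕ} (hd : 1 ≤ d) :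
    relComm (firstCopy h) d < gamma (firstCopy h) d := by
  obtain ⟨j, rfl⟩ := Nat.exists_eq_add_of_le' hd
  have := normal_firstCopy h
  refine lt_of_le_not_ge (relComm_succ_le _ j) fun hle => ?_
  refine face_toLimit_leftComm_notMem h hh (Equiv.refl (Finset (Fin (j + 1)))) ?_
  rw [← initial_self]
  exact map_face_relComm_le _ _ le_rfl ⟨_, hle (leftComm_mem h j), rfl⟩

/-- The quotient of a group by a term of its lower central series at which the series still descends
has the class that the position of this term suggests. -/
theorem nilpotencyClass_quotient_lowerCentralSeries {S : Type*} [Group S] {j : ℕ}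
    (hj : ¬ (⊤ : Subgroup S).lowerCentralSeries j ≤ (⊤ : Subgroup S).lowerCentralSeries (j + 1)) :
    Group.IsNilpotent (S ⧸ (⊤ : Subgroup S).lowerCentralSeries (j + 1)) ∧
      Group.nilpotencyClass (S ⧸ (⊤ : Subgroup S).lowerCentralSeries (j + 1)) = j + 1 := by
  set K := (⊤ : Subgroup S).lowerCentralSeries (j + 1) with hK
  have key : ∀ c, (⊤ : Subgroup (S ⧸ K)).lowerCentralSeries c = ⊥ ↔
      (⊤ : Subgroup S).lowerCentralSeries c ≤ K := by
    intro c
    have htop : (⊤ : Subgroup S).map (QuotientGroup.mk' K) = ⊤ :=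
      Subgroup.map_top_of_surjective _ (QuotientGroup.mk'_surjective K)
    rw [← htop, ← Subgroup.map_lowerCentralSeries, Subgroup.map_eq_bot_iff, QuotientGroup.ker_mk']
  have hnil : Group.IsNilpotent (S ⧸ K) :=
    Subgroup.nilpotent_iff_lowerCentralSeries.2 ⟨j + 1, (key _).2 le_rfl⟩
  refine ⟨hnil, le_antisymm ?_ ?_⟩
  · exact Subgroup.lowerCentralSeries_eq_bot_iff_nilpotencyClass_le.1 ((key _).2 le_rfl)
  · by_contra hlt
    exact hj ((key j).1 (Subgroup.lowerCentralSeries_eq_bot_iff_nilpotencyClass_le.2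
      (Nat.le_of_lt_succ (not_le.1 hlt))))

theorem exists_subdirect_quotient {h : F ≃* commutator F} (hh : SplitsLetters h) {d : ℕ}
    (hd : 1 ≤ d) :
    ∃ S : Subgroup (Fin (2 ^ d) → Limit h), IsSubdirect S ∧
      ∃ K : Subgroup S, ∃ _ : K.Normal,
        Group.IsNilpotent (S ⧸ K) ∧ Group.nilpotencyClass (S ⧸ K) = d := by
  obtain ⟨j, rfl⟩ := Nat.exists_eq_add_of_le' hd
  let e : Fin (2 ^ (j + 1)) ≃ Finset (Fin (j + 1)) := (Fintype.equivFinOfCardEq (by simp)).symm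
  let S := cube e ⊤ (firstCopy h)
  refine ⟨S, isSubdirect_cube e _, (⊤ : Subgroup S).lowerCentralSeries (j + 1), inferInstance,
    nilpotencyClass_quotient_lowerCentralSeries fun hle => ?_⟩
  have hle' := Subgroup.map_mono (f := S.subtype) hle
  rw [Subgroup.top_subtype_lowerCentralSeries, Subgroup.top_subtype_lowerCentralSeries] at hle'
  refine face_toLimit_leftComm_notMem h hh e (hle' ?_)
  rw [← initial_self]
  exact map_face_lowerCentralSeries_le e _ (Nat.lt_succ_self j) ⟨_, leftComm_mem h j, rfl⟩

end PerfectLimit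

open PerfectLimit in
theorem mainTheorem4 :
    (∃ h : F ≃* commutator F, SplitsLetters h) ∧
    ∀ h : F ≃* commutator F, SplitsLetters h →
      Infinite (Limit h) ∧
      Group.IsPerfect (Limit h) ∧
      (firstCopy h).Normal ∧
      (∀ d : ℕ, 1 ≤ d → relComm (firstCopy h) d < gamma (firstCopy h) d) ∧
      (∀ d : ℕ, 1 ≤ d →
        ∃ S : Subgroup (Fin (2 ^ d) → Limit h), IsSubdirect S ∧
          ∃ K : Subgroup S, ∃ _ : K.Normal,
            Group.IsNilpotent (S ⧸ K) ∧ Group.nilpotencyClass (S ⧸ K) = d) :=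
  ⟨exists_splitsLetters, fun h hh => ⟨infinite_limit h, isPerfect_limit h, normal_firstCopy h,
    fun _ hd => relComm_lt_gamma hh hd, fun _ hd => exists_subdirect_quotient hh hd⟩⟩
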